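/- For integers $0\le r\le m$ let $\mathrm{RM}(r,m)\subseteq\mathbb{F}_2^{2^m}$ be the binary Reed–Muller code: $\mathrm{RM}(0,m)=\{\overline 0,\overline 1\}$, $\mathrm{RM}(m,m)=\mathbb{F}_2^{2^m}$, and $\mathrm{RM}(r,m)=\{(u,u+v) : u\in \mathrm{RM}(r,m-1),\ v\in \mathrm{RM}(r-1,m-1)\}$ for $1\le r\le m-1$. For a linear code $C\subseteq\mathbb{F}_2^n$ let $R_t(C)$, the $t$-th generalized covering radius, be the least integer $\rho$ such that for every $\mathbf v\in\mathbb{F}_2^{t\times n}$ there is $\mathbf c\in\mathbb{F}_2^{t\times n}$, all of whose rows lie in $C$, for which $\mathbf v-\mathbf c$ has at most $\rho$ nonzero columns. Put $R_t(r,m)=R_t(\mathrm{RM}(r,m))$ and $H_2(x)=-x\log_2 x-(1-x)\log_2(1-x)$. **Theorem.** Let $t$ be a natural number and let $\alpha$ be a real number with $\tfrac12<\alpha<1$, both constant. Then, for $m\in\mathbb{N}$, $m\geq 1$, $$t\sqrt{\frac{1-\alpha}{8(\alpha m)^3}}\;2^{mH_2(\alpha)}\,(1+o(1))\;\le\; R_t(\lfloor\alpha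 m\rfloor,m)\;\le\; t\,4^{H_2(\alpha)}\,2^{mH_2(\alpha)}\,(1+o(1)),$$ where the two $o(1)$ terms are functions of $m$ (depending on $t$ and $\alpha$) that tend to $0$ as $m\to\infty$. (When $\alpha m$ is an integer, the middle term is $R_t(\alpha m,m)$.) -/

import Mathlib

open Filter Topology

namespace GenCovering

variable {F : Type*} [Field F] {n : ℕ}

/-- The `t`-weight of a `t × n` matrix: the size of the union of the supports of its rows. -/
noncomputable def tWeight {t : ℕ} (v : Matrix (Fin t) (Fin n) F) : ℕ :=
  (⋃ i : Fin t, Function.support (v i)).ncard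

/-- The `t`-metric on `t × n` matrices. -/
noncomputable def tDist {t : ℕ} (v u : Matrix (Fin t) (Fin n) F) : ℕ :=
  tWeight (v - u)

/-- The ball of radius `r` around `v` in the `t`-metric. -/
def tBall {t : ℕ} (r : ℕ) (v : Matrix (Fin t) (Fin n) F) : Set (Matrix (Fin t) (Fin n) F) :=
  {v' | tDist v v' ≤ r}

/-- `C^t`: the `t × n` matrices all of whose rows are codewords of the linear code `C`. -/
def codePower (C : Submodule F (Fin n → F)) (t : ℕ) : Set (Matrix (Fin t) (Fin n) F) :=
  {c | ∀ i : Fin t, c i ∈ C}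

/-- The `t`-th generalized covering radius of the linear code `C`: the minimal `r` such that the
balls of radius `r` (in the `t`-metric) centered at the elements of `C^t` cover all `t × n`
matrices. -/
noncomputable def genCoveringRadius (C : Submodule F (Fin n → F)) (t : ℕ) : ℕ :=
  sInf {r : ℕ | (⋃ c ∈ codePower C t, tBall r c) = Set.univ}

/-- The set of radii in the definition of the generalized covering radius is never empty: the
radius `n` always covers, so the infimum is a genuine minimum. -/
theorem genCoveringRadius_set_nonempty (C : Submodule F (Fin n → F)) (t : ℕ) :
    {r : ℕ | (⋃ c ∈ codePower C t, tBall r c) = Set.univ}.Nonempty := by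
  refine ⟨n, Set.eq_univ_of_forall fun v => ?_⟩
  refine Set.mem_biUnion (x := 0) (fun i => C.zero_mem) ?_
  change (⋃ i : Fin t, Function.support ((0 - v) i)).ncard ≤ n
  simpa using Set.ncard_le_card (⋃ i : Fin t, Function.support ((0 - v) i))

/-- The `(u, u + v)` construction: from codes `C₁`, `C₂` of length `n`, the code of length
`N = n + n` consisting of the concatenations `(u, u + v)` with `u ∈ C₁` and `v ∈ C₂`. -/
def uuvCode {N : ℕ} (hN : N = n + n) (C₁ C₂ : Submodule F (Fin n → F)) :
    Submodule F (Fin N → F) where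
  carrier := {w | ∃ u ∈ C₁, ∃ v ∈ C₂, w = Fin.append u (u + v) ∘ Fin.cast hN}
  zero_mem' := by
    subst hN
    refine ⟨0, C₁.zero_mem, 0, C₂.zero_mem, ?_⟩
    funext i
    refine Fin.addCases (fun j => ?_) (fun j => ?_) i <;> simp [-Fin.natAdd_eq_addNat]
  add_mem' := by
    subst hN
    rintro _ _ ⟨u, hu, v, hv, rfl⟩ ⟨u', hu', v', hv', rfl⟩
    refine ⟨u + u', C₁.add_mem hu hu', v + v', C₂.add_mem hv hv', ?_⟩
    funext i
    refine Fin.addCases (fun j => ?_) (fun j => ?_) i <;> simp [-Fin.natAdd_eq_addNat]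
    ring
  smul_mem' := by
    subst hN
    rintro a _ ⟨u, hu, v, hv, rfl⟩
    refine ⟨a • u, C₁.smul_mem a hu, a • v, C₂.smul_mem a hv, ?_⟩
    funext i
    refine Fin.addCases (fun j => ?_) (fun j => ?_) i <;> simp [-Fin.natAdd_eq_addNat]
    ring

/-- The binary Reed-Muller code `RM(r, m)` of length `2 ^ m`: `RM(0, m)` is the repetition code,
`RM(m, m)` is the whole space, and for `1 ≤ r ≤ m - 1` the code `RM(r, m)` is obtained by the
`(u, u + v)` construction from `RM(r, m - 1)` and `RM(r - 1, m - 1)`.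
(For `r > m`, which is outside the usual range, the value is the whole space.) -/
def reedMuller : (r m : ℕ) → Submodule (ZMod 2) (Fin (2 ^ m) → ZMod 2)
  | 0, _ => Submodule.span (ZMod 2) {1}
  | _ + 1, 0 => ⊤
  | r + 1, m + 1 =>
    if m ≤ r then ⊤
    else uuvCode (by rw [pow_succ, mul_two]) (reedMuller (r + 1) m) (reedMuller r m)

/-- `R_t(r, m)`: the `t`-th generalized covering radius of `RM(r, m)`. -/
noncomputable def rmRadius (t r m : ℕ) : ℕ :=
  genCoveringRadius (reedMuller r m) t

/-- The binary entropy function, with logarithms to base `2`. -/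
noncomputable def entropy₂ (x : ℝ) : ℝ :=
  -x * Real.logb 2 x - (1 - x) * Real.logb 2 (1 - x)

end GenCovering

namespace GenCovering

/-! Upper bound: the ordinary covering radius is subadditive under `(u, u + v)`, so Pascal's rule
bounds it for `RM(r, m)` by the redundancy, an initial segment of binomial coefficients
(`exists_mem_reedMuller_ncard_le`). The entropy bound turns this into `2 ^ (m H)`, and treating the
`t` rows separately costs a factor `t`. The factor `4 ^ H` is pure slack. Lower bound: sphere
covering gives `t * m.choose (r + 1) ≤ (m + t) * R_t`. Stirling's formula and Gibbs' inequality
bound that coefficient below. The resulting constant beats the claimed one by a factor tending to `2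
/ √π > 1`, so no error term is needed for large `m`. -/

/-! ### Entropy estimates -/

theorem two_rpow_mul_entropy₂ (x α : ℝ) :
    (2 : ℝ) ^ (x * entropy₂ α) = Real.exp (x * Real.binEntropy α) := by
  have h2 : Real.log 2 ≠ 0 := (Real.log_pos one_lt_two).ne'
  rw [Real.rpow_def_of_pos two_pos]
  congr 1
  simp only [entropy₂, Real.binEntropy, Real.logb, Real.log_inv]
  field_simp
  ring

theorem entropy₂_nonneg {α : ℝ} (h0 : 0 ≤ α) (h1 : α ≤ 1) : 0 ≤ entropy₂ α := by
  have h := two_rpow_mul_entropy₂ 1 α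
  have h' : (1 : ℝ) ≤ 2 ^ (1 * entropy₂ α) := by
    rw [h, one_mul]
    exact Real.one_le_exp (Real.binEntropy_nonneg h0 h1)
  by_contra! hn
  rw [one_mul] at h'
  exact absurd h' (not_le.2 (Real.rpow_lt_one_of_one_lt_of_neg one_lt_two hn))

/-- The entropy bound for an initial segment of a row of Pascal's triangle. -/
theorem sum_choose_le_exp_binEntropy {α : ℝ} (hα : 1 / 2 ≤ α) (hα' : α < 1) {m s : ℕ}
    (hs : ∀ i < s, (i : ℝ) ≤ m * (1 - α)) :
    ((∑ i ∈ Finset.range s, m.choose i : ℕ) : ℝ) ≤ Real.exp (m * Real.binEntropy α) := by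
  have hα0 : 0 < α := by linarith
  have h1α : 0 < 1 - α := by linarith
  have hsm : s ≤ m + 1 := by
    by_contra! h
    have h1 := hs (m + 1) h
    push_cast at h1
    nlinarith [(Nat.cast_nonneg m : (0 : ℝ) ≤ m)]
  -- Compare with the binomial distribution of parameter `1 - α`: as `1 - α ≤ α`, the weight `(1 -
  -- α) ^ i * α ^ (m - i)` decreases in `i`, and at `i = m (1 - α)` it would equal the exponential.
  have hterm : ∀ i ∈ Finset.range s, (m.choose i : ℝ) * Real.exp (-(m * Real.binEntropy α)) ≤
      (1 - α) ^ i * α ^ (m - i) * m.choose i := by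
    intro i hi
    rw [mul_comm]
    refine mul_le_mul_of_nonneg_right ?_ (Nat.cast_nonneg _)
    have him : i ≤ m := by have := Finset.mem_range.1 hi; omega
    rw [← Real.exp_log (pow_pos h1α i), ← Real.exp_log (pow_pos hα0 (m - i)), ← Real.exp_add,
      Real.exp_le_exp, Real.log_pow, Real.log_pow, Nat.cast_sub him, Real.binEntropy,
      Real.log_inv, Real.log_inv]
    have h1 := hs i (Finset.mem_range.1 hi)
    have h2 : Real.log (1 - α) ≤ Real.log α := Real.log_le_log h1α (by linarith)
    nlinarith [mul_nonneg (sub_nonneg.2 h1) (sub_nonneg.2 h2)]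
  have hbin : ∑ i ∈ Finset.range (m + 1), (1 - α) ^ i * α ^ (m - i) * (m.choose i : ℝ) = 1 := by
    rw [← add_pow]; simp
  have hsum : (∑ i ∈ Finset.range s, (m.choose i : ℝ)) * Real.exp (-(m * Real.binEntropy α)) ≤ 1 := by
    rw [Finset.sum_mul, ← hbin]
    refine (Finset.sum_le_sum hterm).trans
      (Finset.sum_le_sum_of_subset_of_nonneg (Finset.range_subset_range.2 hsm) fun i _ _ => ?_)
    positivity
  rw [Real.exp_neg, ← div_eq_mul_inv, div_le_one (Real.exp_pos _)] at hsum
  exact_mod_cast hsum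

/-- Gibbs' inequality against the distribution `(k / m, 1 - k / m)`. -/
theorem exp_binEntropy_le {α : ℝ} (hα : 1 / 2 ≤ α) (hα' : α < 1) {m k : ℕ} (hkm : k < m)
    (hk : α * m ≤ k) (hk' : (k : ℝ) ≤ α * m + 1) :
    Real.exp (m * Real.binEntropy α) ≤
      (m : ℝ) ^ m / ((k : ℝ) ^ k * (m - k : ℝ) ^ (m - k)) * (k / (m - k)) := by
  have hm : (0 : ℝ) < m := by exact_mod_cast (Nat.zero_le k).trans_lt hkm
  have hα0 : 0 < α := by linarith
  have h1α : 0 < 1 - α := by linarith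
  have hk0 : (0 : ℝ) < k := by nlinarith
  have hmk : (0 : ℝ) < m - k := by rw [sub_pos]; exact_mod_cast hkm
  rw [← Real.le_log_iff_exp_le (by positivity), Real.log_mul (by positivity) (by positivity),
    Real.log_div (by positivity) (by positivity), Real.log_div hk0.ne' hmk.ne',
    Real.log_mul (by positivity) (by positivity), Real.log_pow, Real.log_pow, Real.log_pow,
    Nat.cast_sub hkm.le, Real.binEntropy, Real.log_inv, Real.log_inv]
  have g1 := Real.log_le_sub_one_of_pos (show 0 < k / (m * α) by positivity)
  have g2 := Real.log_le_sub_one_of_pos (show 0 < (m - k) / (m * (1 - α)) by positivity)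
  rw [Real.log_div (by positivity) (by positivity), Real.log_mul (by positivity) (by positivity)]
    at g1 g2
  have g1' := mul_le_mul_of_nonneg_left g1 (show 0 ≤ m * α by positivity)
  have g2' := mul_le_mul_of_nonneg_left g2 (show 0 ≤ m * (1 - α) by positivity)
  have e1 : m * α * (k / (m * α) - 1) = k - m * α := by field_simp
  have e2 : m * (1 - α) * ((m - k) / (m * (1 - α)) - 1) = (m - k) - m * (1 - α) := by field_simp
  rw [e1] at g1'
  rw [e2] at g2'
  -- Gibbs gives weights `mα`, `m(1 - α)` on the logarithms; moving to `k`, `m - k` costs `(k - αm)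
  -- * log (k / (m - k))`. As `k - αm ≤ 1`, the factor `k / (m - k)` pays for it.
  have hl : Real.log (m - k) ≤ Real.log k := Real.log_le_log hmk (by nlinarith)
  nlinarith [mul_nonneg (sub_nonneg.2 hk') (sub_nonneg.2 hl)]


/-! ### Upper bound: covering by redundancy -/

theorem ncard_support_append_le {R : Type*} [Zero R] {n N : ℕ} (hN : N = n + n)
    (u v : Fin n → R) :
    (Function.support (Fin.append u v ∘ Fin.cast hN)).ncard ≤
      (Function.support u).ncard + (Function.support v).ncard := by
  subst hN
  have h : Function.support (Fin.append u v ∘ Fin.cast rfl) ⊆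
      Fin.castAdd n '' Function.support u ∪ Fin.natAdd n '' Function.support v := by
    intro i
    refine Fin.addCases (fun j => ?_) (fun j => ?_) i <;> intro hj
    · exact Or.inl ⟨j, by simpa using hj, rfl⟩
    · exact Or.inr ⟨j, by simpa [-Fin.natAdd_eq_addNat] using hj, rfl⟩
  exact (Set.ncard_le_ncard h (Set.toFinite _)).trans ((Set.ncard_union_le _ _).trans
    (add_le_add (Set.ncard_image_le (Set.toFinite _)) (Set.ncard_image_le (Set.toFinite _))))

/-- The covering radius of the `(u, u + v)` construction is subadditive. -/
theorem exists_mem_uuvCode_ncard_le {F : Type*} [Field F] {n N : ℕ} (hN : N = n + n)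
    {C₁ C₂ : Submodule F (Fin n → F)} {a b : ℕ}
    (h₁ : ∀ x, ∃ c ∈ C₁, (Function.support (x - c)).ncard ≤ a)
    (h₂ : ∀ x, ∃ c ∈ C₂, (Function.support (x - c)).ncard ≤ b) (x : Fin N → F) :
    ∃ c ∈ uuvCode hN C₁ C₂, (Function.support (x - c)).ncard ≤ a + b := by
  obtain ⟨u, hu, hua⟩ := h₁ fun j => x (Fin.cast hN.symm (Fin.castAdd n j))
  obtain ⟨v, hv, hvb⟩ := h₂ ((fun j => x (Fin.cast hN.symm (Fin.natAdd n j))) - u)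
  refine ⟨_, ⟨u, hu, v, hv, rfl⟩, ?_⟩
  refine le_trans (le_of_eq ?_) ((ncard_support_append_le hN _ _).trans (add_le_add hua hvb))
  subst hN
  congr 2
  funext i
  refine Fin.addCases (fun j => ?_) (fun j => ?_) i <;>
    simp [-Fin.natAdd_eq_addNat, sub_sub]

/-- The covering radius of a Reed-Muller code is at most its redundancy. -/
theorem exists_mem_reedMuller_ncard_le (r m : ℕ) (x : Fin (2 ^ m) → ZMod 2) :
    ∃ c ∈ reedMuller r m,
      (Function.support (x - c)).ncard ≤ ∑ i ∈ Finset.range (m - r), m.choose i := by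
  induction m generalizing r with
  | zero =>
    cases r with
    | zero =>
      refine ⟨x, ?_, by simp⟩
      rw [reedMuller, Submodule.mem_span_singleton]
      exact ⟨x 0, by funext i; rw [show i = 0 from Fin.ext (by simp)]; simp⟩
    | succ r => exact ⟨x, by rw [reedMuller]; trivial, by simp⟩
  | succ m ih =>
    cases r with
    | zero =>
      -- The bound is one less than the length, so the zero codeword serves every `x` except the
      -- all-ones word, itself a codeword.
      have hs : ∑ i ∈ Finset.range (m + 1 - 0), (m + 1).choose i + 1 = 2 ^ (m + 1) := by
        rw [← Nat.sum_range_choose (m + 1), Finset.sum_range_succ _ (m + 1)]; simp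
      by_cases hx : x = 1
      · exact ⟨x, by rw [reedMuller, hx]; exact Submodule.mem_span_singleton_self _, by simp⟩
      · refine ⟨0, zero_mem _, ?_⟩
        have hne : Function.support (x - 0) ≠ Set.univ := by
          intro h
          refine hx (funext fun i => ?_)
          have hi : x i ≠ 0 := by simpa using (Set.ext_iff.1 h i).2 trivial
          exact Fin.eq_one_of_ne_zero (x i) hi
        have hlt := Set.ncard_lt_ncard (Set.ssubset_univ_iff.2 hne) (Set.toFinite _)
        rw [Set.ncard_univ, Nat.card_eq_fintype_card, Fintype.card_fin] at hlt
        omega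
    | succ r =>
      rw [reedMuller]
      split_ifs with h
      · exact ⟨x, trivial, by simp⟩
      · obtain ⟨s, hs⟩ : ∃ s, m - r = s + 1 := ⟨m - r - 1, by omega⟩
        obtain ⟨c, hc, hw⟩ := exists_mem_uuvCode_ncard_le (by rw [pow_succ, mul_two])
          (ih (r + 1)) (ih r) x
        refine ⟨c, hc, hw.trans (le_of_eq ?_)⟩
        rw [show m + 1 - (r + 1) = s + 1 by omega, show m - (r + 1) = s by omega, hs,
          Finset.sum_range_succ', Finset.sum_range_succ' _ s]
        simp only [Nat.choose_succ_succ, Finset.sum_add_distrib]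
        simp
        ring

theorem genCoveringRadius_le_mul {F : Type*} [Field F] {n : ℕ} {C : Submodule F (Fin n → F)}
    {ρ : ℕ} (h : ∀ x, ∃ c ∈ C, (Function.support (x - c)).ncard ≤ ρ) (t : ℕ) :
    genCoveringRadius C t ≤ t * ρ := by
  refine Nat.sInf_le (Set.eq_univ_of_forall fun v => ?_)
  choose f hf hw using h
  refine Set.mem_biUnion (x := fun i => f (v i)) (fun i => hf _) ?_
  change (⋃ i : Fin t, Function.support (f (v i) - v i)).ncard ≤ t * ρ
  refine (Set.ncard_iUnion_le_of_fintype _).trans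
    ((Finset.sum_le_card_nsmul _ _ ρ fun i _ => ?_).trans (by simp))
  rw [← neg_sub, Function.support_neg]
  exact hw _

/-! ### Dimension and sphere covering -/

theorem card_uuvCode_le {F : Type*} [Field F] [Finite F] {n N : ℕ} (hN : N = n + n)
    (C₁ C₂ : Submodule F (Fin n → F)) :
    Nat.card (uuvCode hN C₁ C₂) ≤ Nat.card C₁ * Nat.card C₂ := by
  rw [← Nat.card_prod]
  refine Nat.card_le_card_of_surjective (fun p : C₁ × C₂ =>
    (⟨_, ⟨p.1.1, p.1.2, p.2.1, p.2.2, rfl⟩⟩ : uuvCode hN C₁ C₂)) ?_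
  rintro ⟨_, u, hu, v, hv, rfl⟩
  exact ⟨(⟨u, hu⟩, ⟨v, hv⟩), rfl⟩

/-- The dimension of `RM(r, m)` is at most `∑ i ≤ r, m.choose i`. -/
theorem card_reedMuller_le (r m : ℕ) :
    Nat.card (reedMuller r m) ≤ 2 ^ ∑ i ∈ Finset.range (r + 1), m.choose i := by
  have htop : ∀ m, Nat.card (⊤ : Submodule (ZMod 2) (Fin (2 ^ m) → ZMod 2)) = 2 ^ 2 ^ m := by
    intro m
    rw [Nat.card_congr (Submodule.topEquiv (R := ZMod 2)).toEquiv]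
    simp
  induction m generalizing r with
  | zero =>
    calc Nat.card (reedMuller r 0) ≤ Nat.card (Fin (2 ^ 0) → ZMod 2) :=
          Nat.card_le_card_of_injective _ Subtype.val_injective
      _ = 2 ^ ∑ i ∈ Finset.range (r + 1), Nat.choose 0 i := by
          rw [Finset.sum_range_succ']; simp
  | succ m ih =>
    cases r with
    | zero =>
      rw [reedMuller]
      refine (Nat.card_le_card_of_surjective (fun a : ZMod 2 => (⟨a • 1,
        Submodule.mem_span_singleton.2 ⟨a, rfl⟩⟩ :
          Submodule.span (ZMod 2) {(1 : Fin (2 ^ (m + 1)) → ZMod 2)})) ?_).trans ?_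
      · rintro ⟨y, hy⟩
        obtain ⟨a, rfl⟩ := Submodule.mem_span_singleton.1 hy
        exact ⟨a, rfl⟩
      · simp
    | succ r =>
      rw [reedMuller]
      split_ifs with h
      · rw [htop]
        refine Nat.pow_le_pow_right two_pos ?_
        rw [← Nat.sum_range_choose (m + 1)]
        exact Finset.sum_le_sum_of_subset (Finset.range_subset_range.2 (by omega))
      · refine (card_uuvCode_le _ _ _).trans ((Nat.mul_le_mul (ih (r + 1)) (ih r)).trans ?_)
        rw [← pow_add]
        refine le_of_eq (congrArg _ ?_)
        rw [Finset.sum_range_succ' _ (r + 1), Finset.sum_range_succ' _ (r + 1)]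
        simp only [Nat.choose_succ_succ, Finset.sum_add_distrib]
        simp
        ring

/-- The sphere-covering bound, with the ball of radius `ρ` counted by lists of `ρ` columns. -/
theorem card_le_mul_pow_genCoveringRadius {F : Type*} [Field F] [Finite F] {n : ℕ} [NeZero n]
    (C : Submodule F (Fin n → F)) (t : ℕ) :
    Nat.card F ^ (n * t) ≤
      Nat.card C ^ t * (n * Nat.card F ^ t) ^ genCoveringRadius C t := by
  set ρ := genCoveringRadius C t with hρ
  have hcov : (⋃ c ∈ codePower C t, tBall ρ c) = Set.univ :=
    Nat.sInf_mem (genCoveringRadius_set_nonempty C t)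
  let f : (Fin t → C) × (Fin ρ → Fin n × (Fin t → F)) → Matrix (Fin t) (Fin n) F :=
    fun p i j => (p.1 i : Fin n → F) j - ∑ l, if (p.2 l).1 = j then (p.2 l).2 i else 0
  have hf : Function.Surjective f := by
    classical
    intro v
    obtain ⟨c, hc, hcv⟩ := Set.mem_iUnion₂.1 (hcov.symm ▸ Set.mem_univ v)
    change (⋃ i : Fin t, Function.support ((c - v) i)).ncard ≤ ρ at hcv
    set S := ⋃ i : Fin t, Function.support ((c - v) i) with hS
    obtain ⟨g⟩ : Nonempty (S ↪ Fin ρ) := by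
      rw [Function.Embedding.nonempty_iff_card_le]
      rw [Set.ncard_eq_toFinset_card', Set.toFinset_card] at hcv
      simpa using hcv
    -- Unused slots carry the zero column, so their position is irrelevant.
    let e : Fin ρ → Fin n × (Fin t → F) := fun l =>
      if h : ∃ s, g s = l then (h.choose.1, fun i => (c - v) i h.choose.1) else (0, 0)
    have he : ∀ s, e (g s) = (s.1, fun i => (c - v) i s.1) := by
      intro s
      have h : ∃ s', g s' = g s := ⟨s, rfl⟩
      have h' : h.choose = s := g.injective h.choose_spec
      simp only [e, dif_pos h, h']
    have he' : ∀ l, (∀ s, g s ≠ l) → e l = (0, 0) := by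
      intro l hl
      exact dif_neg (by simpa using hl)
    refine ⟨(fun i => ⟨c i, hc i⟩, e), ?_⟩
    funext i j
    have hsum : (∑ l, if (e l).1 = j then (e l).2 i else 0) = (c - v) i j := by
      by_cases hj : j ∈ S
      · rw [Finset.sum_eq_single (g ⟨j, hj⟩)]
        · simp [he]
        · intro l _ hl
          by_cases h : ∃ s, g s = l
          · obtain ⟨s, rfl⟩ := h
            rw [he, if_neg]
            rintro rfl
            exact hl rfl
          · rw [he' l (by simpa using h)]; simp
        · simp
      · rw [Finset.sum_eq_zero]
        · by_contra hne
          exact hj (Set.mem_iUnion.2 ⟨i, fun h0 => hne h0.symm⟩)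
        · intro l _
          by_cases h : ∃ s, g s = l
          · obtain ⟨s, rfl⟩ := h
            rw [he, if_neg]
            rintro rfl
            exact hj s.2
          · rw [he' l (by simpa using h)]; simp
    change c i j - (∑ l, if (e l).1 = j then (e l).2 i else 0) = v i j
    rw [hsum]
    exact sub_sub_cancel (c i j) (v i j)
  have := Nat.card_le_card_of_surjective f hf
  simpa [Matrix, Nat.card_fun, Nat.card_prod, pow_mul] using this

/-- Exponents of 2 in the sphere-covering bound: each listed column costs `m + t` bits. Of the
redundancy, only its largest-index-side neighbour of `r`, the layer `r + 1`, is kept. -/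
theorem mul_choose_le_mul_rmRadius (t : ℕ) {r m : ℕ} (hr : r < m) :
    t * m.choose (r + 1) ≤ (m + t) * rmRadius t r m := by
  have h := card_le_mul_pow_genCoveringRadius (reedMuller r m) t
  have h' := h.trans (Nat.mul_le_mul_right _ (Nat.pow_le_pow_left (card_reedMuller_le r m) t))
  rw [Nat.card_zmod, ← pow_mul, ← pow_add, ← pow_mul, ← pow_add,
    Nat.pow_le_pow_iff_right one_lt_two] at h'
  have hs : ∑ i ∈ Finset.range (r + 1), m.choose i + m.choose (r + 1) ≤ 2 ^ m := by
    rw [← Finset.sum_range_succ, ← Nat.sum_range_choose m]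
    exact Finset.sum_le_sum_of_subset (Finset.range_subset_range.2 (by omega))
  have := Nat.mul_le_mul_right t hs
  rw [rmRadius]
  linarith


/-! ### Lower bound: Stirling asymptotics -/

theorem choose_eq_stirlingSeq {k j : ℕ} (hk : k ≠ 0) (hj : j ≠ 0) :
    ((k + j).choose k : ℝ) =
      Stirling.stirlingSeq (k + j) / (Stirling.stirlingSeq k * Stirling.stirlingSeq j) *
        √((k + j : ℝ) / (2 * k * j)) * ((k + j : ℝ) ^ (k + j) / ((k : ℝ) ^ k * (j : ℝ) ^ j)) := by
  have hk' : (0 : ℝ) < k := by exact_mod_cast Nat.pos_of_ne_zero hk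
  have hj' : (0 : ℝ) < j := by exact_mod_cast Nat.pos_of_ne_zero hj
  have hs : √((k + j : ℝ) / (2 * k * j)) = √(2 * (k + j)) / (√(2 * k) * √(2 * j)) := by
    rw [← Real.sqrt_mul (by positivity), ← Real.sqrt_div (by positivity)]
    congr 1
    field_simp
  have h1 : √(2 * (k + j : ℝ)) ≠ 0 := by positivity
  have h2 : √(2 * k : ℝ) ≠ 0 := by positivity
  have h3 : √(2 * j : ℝ) ≠ 0 := by positivity
  rw [hs, Nat.choose_symm_add, Nat.add_choose, Nat.cast_div (Nat.factorial_mul_factorial_dvd_factorial_add k j)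
    (by positivity)]
  simp only [Stirling.stirlingSeq, div_pow, Nat.cast_mul, Nat.cast_add, pow_add (Real.exp 1)]
  have h4 : (k + j : ℝ) ^ (k + j) ≠ 0 := by positivity
  field_simp

theorem exp_binEntropy_mul_le_choose {α : ℝ} (hα : 1 / 2 ≤ α) (hα' : α < 1) {m k : ℕ}
    (hkm : k < m) (hk : α * m ≤ k) (hk' : (k : ℝ) ≤ α * m + 1) :
    √Real.pi / (Stirling.stirlingSeq k * Stirling.stirlingSeq (m - k)) *
      √((m : ℝ) / (2 * k * (m - k : ℕ))) * ((m - k : ℕ) / k) *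
        Real.exp (m * Real.binEntropy α) ≤ m.choose k := by
  obtain ⟨j, rfl⟩ := Nat.exists_eq_add_of_lt hkm
  rw [show k + j + 1 = k + (j + 1) by ring] at *
  generalize hj : j + 1 = j' at *
  have hj0 : j' ≠ 0 := by omega
  have hk0 : k ≠ 0 := by
    rintro rfl
    have : (0 : ℝ) < (0 + j' : ℕ) := by exact_mod_cast hkm
    simp only [Nat.cast_zero] at hk
    nlinarith
  have hkp : (0 : ℝ) < k := by exact_mod_cast Nat.pos_of_ne_zero hk0
  have hjp : (0 : ℝ) < j' := by exact_mod_cast Nat.pos_of_ne_zero hj0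
  have hπ : 0 < √Real.pi := by have := Real.pi_pos; positivity
  have hs : ∀ n : ℕ, n ≠ 0 → 0 < Stirling.stirlingSeq n := fun n hn =>
    hπ.trans_le (Stirling.sqrt_pi_le_stirlingSeq hn)
  have hsk := hs k hk0
  have hsj := hs j' hj0
  have hE := exp_binEntropy_le hα hα' hkm hk hk'
  rw [choose_eq_stirlingSeq hk0 hj0]
  simp only [Nat.add_sub_cancel_left, Nat.cast_add, add_sub_cancel_left] at hE ⊢
  have hE' : (j' : ℝ) / k * Real.exp ((k + j') * Real.binEntropy α) ≤
      (k + j' : ℝ) ^ (k + j') / ((k : ℝ) ^ k * (j' : ℝ) ^ j') := by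
    calc _ ≤ (j' : ℝ) / k * _ := mul_le_mul_of_nonneg_left hE (by positivity)
      _ = _ := by field_simp
  rw [mul_assoc]
  have := Stirling.sqrt_pi_le_stirlingSeq (n := k + j') (by omega)
  have hskj := hπ.trans_le this
  gcongr

theorem tendsto_floor_mul_add_one_div {α : ℝ} (hα : 0 ≤ α) :
    Tendsto (fun m : ℕ => ((⌊α * m⌋₊ + 1 : ℕ) : ℝ) / m) atTop (𝓝 α) := by
  have h1 := (tendsto_nat_floor_mul_div_atTop hα).comp tendsto_natCast_atTop_atTop
  have h2 := tendsto_one_div_atTop_nhds_zero_nat (𝕜 := ℝ)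
  simpa [add_div] using h1.add h2

theorem eventually_le_rmRadius (t : ℕ) {α : ℝ} (hα : 1 / 2 < α) (hα' : α < 1) :
    ∀ᶠ m : ℕ in atTop,
      (t : ℝ) * √((1 - α) / (8 * (α * m) ^ 3)) * Real.exp (m * Real.binEntropy α) ≤
        rmRadius t ⌊α * m⌋₊ m := by
  have hα0 : 0 < α := by linarith
  have h1α : 0 < 1 - α := by linarith
  set k : ℕ → ℕ := fun m => ⌊α * m⌋₊ + 1 with hkdef
  have hlim : Tendsto (fun m => (k m : ℝ) / m) atTop (𝓝 α) :=
    tendsto_floor_mul_add_one_div hα0.le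
  have hlt : ∀ᶠ m : ℕ in atTop, k m < m := by
    filter_upwards [hlim.eventually_lt_const hα', eventually_gt_atTop 0] with m hm hm0
    rw [div_lt_one (by exact_mod_cast hm0)] at hm
    exact_mod_cast hm
  have hlim' : Tendsto (fun m => ((m - k m : ℕ) : ℝ) / m) atTop (𝓝 (1 - α)) := by
    refine (hlim.const_sub 1).congr' ?_
    filter_upwards [hlt] with m hm
    have : (m : ℝ) ≠ 0 := by exact_mod_cast (by omega : m ≠ 0)
    rw [Nat.cast_sub hm.le]
    field_simp
  have hdiv : ∀ {f : ℕ → ℕ} {c : ℝ}, 0 < c → Tendsto (fun m => (f m : ℝ) / m) atTop (𝓝 c) →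
      Tendsto f atTop atTop := by
    intro f c hc hf
    refine tendsto_natCast_atTop_iff.1 ((hf.pos_mul_atTop hc tendsto_natCast_atTop_atTop).congr' ?_)
    filter_upwards [eventually_gt_atTop 0] with m hm
    have : (m : ℝ) ≠ 0 := by exact_mod_cast hm.ne'
    field_simp
  have hπ : 0 < √Real.pi := Real.sqrt_pos.2 Real.pi_pos
  have hst := Stirling.tendsto_stirlingSeq_sqrt_pi
  have hmt : Tendsto (fun m : ℕ => (m : ℝ) / (m + t)) atTop (𝓝 1) :=
    tendsto_natCast_div_add_atTop (t : ℝ)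
  -- This is the Stirling–Gibbs lower bound divided by the target. Its limit is `2 / √π`, and `π <
  -- 4` makes it exceed 1.
  have hQ : Tendsto (fun m : ℕ => √Real.pi /
      (Stirling.stirlingSeq (k m) * Stirling.stirlingSeq (m - k m)) *
      √(4 * ((m - k m : ℕ) / m) * α ^ 3 / ((k m / m) ^ 3 * (1 - α))) * (m / (m + t)))
      atTop (𝓝 (√Real.pi / (√Real.pi * √Real.pi) *
        √(4 * (1 - α) * α ^ 3 / (α ^ 3 * (1 - α))) * 1)) := by
    refine Tendsto.mul (Tendsto.mul (Tendsto.div tendsto_const_nhds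
      ((hst.comp (hdiv hα0 hlim)).mul (hst.comp (hdiv h1α hlim'))) (by positivity))
      (Tendsto.sqrt (Tendsto.div ((hlim'.const_mul 4).mul_const _) ((hlim.pow 3).mul_const _)
        (by positivity)))) hmt
  have hgt : 1 < √Real.pi / (√Real.pi * √Real.pi) *
        √(4 * (1 - α) * α ^ 3 / (α ^ 3 * (1 - α))) * 1 := by
    have h4 : 4 * (1 - α) * α ^ 3 / (α ^ 3 * (1 - α)) = 2 ^ 2 := by field_simp; norm_num
    rw [h4, Real.sqrt_sq two_pos.le, div_mul_cancel_left₀ hπ.ne', mul_one, inv_mul_eq_div,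
      one_lt_div hπ, Real.sqrt_lt' two_pos]
    linarith [Real.pi_lt_four]
  filter_upwards [hQ.eventually_const_lt hgt, hlt] with m hQm hkm
  have hm : (0 : ℝ) < m := by exact_mod_cast (Nat.zero_le _).trans_lt hkm
  have hmt0 : (0 : ℝ) < m + t := by positivity
  have hkp : (0 : ℝ) < k m := by positivity
  have hjp : (0 : ℝ) < (m - k m : ℕ) := by exact_mod_cast Nat.sub_pos_of_lt hkm
  have hC := exp_binEntropy_mul_le_choose hα.le hα' hkm
    (by simpa [hkdef] using (Nat.lt_floor_add_one (α * m)).le)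
    (by simpa [hkdef] using Nat.floor_le (show 0 ≤ α * m by positivity))
  have hR : (t : ℝ) * m.choose (k m) ≤ (m + t) * rmRadius t ⌊α * m⌋₊ m := by
    exact_mod_cast mul_choose_le_mul_rmRadius t (r := ⌊α * m⌋₊) (by simp only [hkdef] at hkm; omega)
  have hsq : √(4 * ((m - k m : ℕ) / m) * α ^ 3 / ((k m / m : ℝ) ^ 3 * (1 - α))) * m *
      √((1 - α) / (8 * (α * m) ^ 3)) =
      √((m : ℝ) / (2 * k m * (m - k m : ℕ))) * ((m - k m : ℕ) / k m) := by
    rw [← sq_eq_sq₀ (by positivity) (by positivity), mul_pow (√_ * _) √_, mul_pow √_ (m : ℝ),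
      mul_pow √_ (_ / _),
      Real.sq_sqrt (by positivity), Real.sq_sqrt (by positivity), Real.sq_sqrt (by positivity)]
    field_simp
    norm_num
  set A := √((1 - α) / (8 * (α * m) ^ 3))
  set E := Real.exp (m * Real.binEntropy α)
  set S := √Real.pi / (Stirling.stirlingSeq (k m) * Stirling.stirlingSeq (m - k m))
  set X := √(4 * ((m - k m : ℕ) / m) * α ^ 3 / ((k m / m : ℝ) ^ 3 * (1 - α)))
  have hA : (m + t) * A ≤ S * (X * m * A) := by
    have h : (m + t : ℝ) ≤ S * X * m := by
      rw [← mul_div_assoc, lt_div_iff₀ hmt0, one_mul] at hQm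
      exact hQm.le
    calc (m + t) * A ≤ S * X * m * A := mul_le_mul_of_nonneg_right h (Real.sqrt_nonneg _)
      _ = _ := by ring
  rw [hsq, ← mul_assoc] at hA
  have hfin := mul_le_mul_of_nonneg_left ((mul_le_mul_of_nonneg_right hA
    (Real.exp_pos (m * Real.binEntropy α)).le).trans hC) (Nat.cast_nonneg (α := ℝ) t)
  refine le_of_mul_le_mul_left (le_trans (le_of_eq ?_) (hfin.trans hR)) hmt0
  ring

theorem rmRadius_le (t : ℕ) {α : ℝ} (hα : 1 / 2 < α) (hα' : α < 1) (m : ℕ) :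
    (rmRadius t ⌊α * m⌋₊ m : ℝ) ≤ t * Real.exp (m * Real.binEntropy α) := by
  have h : rmRadius t ⌊α * m⌋₊ m ≤ t * _ :=
    genCoveringRadius_le_mul (exists_mem_reedMuller_ncard_le ⌊α * m⌋₊ m) t
  have h' := sum_choose_le_exp_binEntropy hα.le hα' (m := m) (s := m - ⌊α * m⌋₊) fun i hi => by
    -- The strict `i < m - ⌊αm⌋` supplies the 1 that absorbs the rounding of `αm`.
    have h1 : ((i + 1 + ⌊α * m⌋₊ : ℕ) : ℝ) ≤ m := by exact_mod_cast (by omega)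
    have h2 := Nat.lt_floor_add_one (α * m)
    push_cast at h1
    linarith
  calc (rmRadius t ⌊α * m⌋₊ m : ℝ) ≤
        t * ((∑ i ∈ Finset.range (m - ⌊α * m⌋₊), m.choose i : ℕ) : ℝ) := by exact_mod_cast h
    _ ≤ _ := mul_le_mul_of_nonneg_left h' (Nat.cast_nonneg _)

end GenCovering

theorem mainTheorem6 (t : ℕ) (α : ℝ) (hα : 1 / 2 < α) (hα' : α < 1) :
    ∃ ε δ : ℕ → ℝ, Tendsto ε atTop (𝓝 0) ∧ Tendsto δ atTop (𝓝 0) ∧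
      ∀ m : ℕ, 1 ≤ m →
        (t : ℝ) * Real.sqrt ((1 - α) / (8 * (α * (m : ℝ)) ^ 3)) *
            (2 : ℝ) ^ ((m : ℝ) * GenCovering.entropy₂ α) * (1 + ε m)
          ≤ (GenCovering.rmRadius t ⌊α * (m : ℝ)⌋₊ m : ℝ) ∧
        (GenCovering.rmRadius t ⌊α * (m : ℝ)⌋₊ m : ℝ)
          ≤ (t : ℝ) * (4 : ℝ) ^ GenCovering.entropy₂ α *
            (2 : ℝ) ^ ((m : ℝ) * GenCovering.entropy₂ α) * (1 + δ m) := by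
  obtain ⟨M, hM⟩ := eventually_atTop.1 (GenCovering.eventually_le_rmRadius t hα hα')
  -- The value `-1` makes the lower bound zero for the finitely many `m` below the threshold.
  refine ⟨fun m => if M ≤ m then 0 else -1, fun _ => 0, ?_, tendsto_const_nhds, fun m _ => ⟨?_, ?_⟩⟩
  · refine tendsto_const_nhds.congr' ?_
    filter_upwards [eventually_ge_atTop M] with m hm
    rw [if_pos hm]
  · rw [GenCovering.two_rpow_mul_entropy₂]
    by_cases hm : M ≤ m
    · simpa only [if_pos hm, add_zero, mul_one] using hM m hm
    · simp [if_neg hm]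
  · rw [GenCovering.two_rpow_mul_entropy₂, add_zero, mul_one]
    refine (GenCovering.rmRadius_le t hα hα' m).trans ?_
    refine mul_le_mul_of_nonneg_right ?_ (Real.exp_pos _).le
    exact le_mul_of_one_le_right (Nat.cast_nonneg _) (Real.one_le_rpow (by norm_num)
      (GenCovering.entropy₂_nonneg (by linarith) hα'.le))
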